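/- Here both integrals are taken in $[0,+\infty]$ and $\ln(+\infty)=+\infty$. (1) Let $n>1$ be a real number, let $[n]$ be its integer part, and put $$C_n=\int_0^1\frac{1-(1-t)^{n-[n]}}{t}\,dt+\sum_{i=1}^{[n]-1}\frac1{n-i}.$$ For every nonnegative $u\in C^1[0,\infty)$ with $u(0)=0$, $$\ln\Big(n\int_0^\infty e^{n(u(r)-r)}\,dr\Big)\le\Big(\frac{n-1}{n}\Big)^{n-1}\int_0^\infty|u'(r)|^n\,dr+C_n .$$ Equality never holds when the right-hand side is finite: the inequality is then strict (in particular the left-hand side is finite). Both constants are optimal: for every real $A<\left(\frac{n-1}{n}\right)^{n-1}$ and every real $C$ there is a nonnegative $u\in C^1[0,\infty)$ with $u(0)=0$ and $\int_0^\infty|u'|^n\,dr<\infty$ such that $\ln\big(n\int_0^\infty e^{n(u-r)}\,dr\big)>A\int_0^\infty|u'|^n\,dr+C$; and for every real $C<C_n$ there is such a $u$ with $\ln\big(n\int_0^\infty e^{n(u-r)}\,dr\big)>\left(\frac{n-1}{n}\right)^{n-1}\int_0^\infty|u'|^n\,dr+C$. (2) For every nonnegative $u\in C^1[0,\infty)$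 with $u(0)=0$, $$\ln\int_0^\infty e^{u(r)-r}\,dr\le\int_0^\infty|u'(r)|\,dr.$$ -/

import Mathlib

open MeasureTheory Set

noncomputable section

namespace ExpHardy

/-- Nonnegative `u ∈ C¹[0, ∞)` with `u 0 = 0` (values of `u` at negative arguments are
irrelevant; `u` is `C¹` up to the endpoint `0`). -/
structure Admissible (u : ℝ → ℝ) : Prop where
  contDiffOn : ContDiffOn ℝ 1 u (Ici 0)
  nonneg : ∀ r, 0 ≤ r → 0 ≤ u r
  zero : u 0 = 0

/-- `∫₀^∞ e^{n(u - r)} dr`, with value in `[0, ∞]`. -/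
def expIntegral (n : ℝ) (u : ℝ → ℝ) : ENNReal :=
  ∫⁻ r in Ioi (0 : ℝ), ENNReal.ofReal (Real.exp (n * (u r - r)))

/-- `∫₀^∞ |u_r|^n dr`, with value in `[0, ∞]`. -/
def energy (n : ℝ) (u : ℝ → ℝ) : ENNReal :=
  ∫⁻ r in Ioi (0 : ℝ), ENNReal.ofReal (|deriv u r| ^ n)

/-- The coefficient `((n - 1) / n) ^ (n - 1)`. -/
def sharpCoeff (n : ℝ) : ℝ := ((n - 1) / n) ^ (n - 1)

/-- The additive constant
`C_n = ∫₀¹ (1 - (1 - t)^{n - [n]}) / t dt + ∑_{i = 1}^{[n] - 1} 1 / (n - i)`. -/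
def sharpConst (n : ℝ) : ℝ :=
  (∫ t in (0 : ℝ)..1, 1 / t * (1 - (1 - t) ^ (n - (⌊n⌋₊ : ℝ)))) +
    ∑ i ∈ Finset.Icc 1 (⌊n⌋₊ - 1), 1 / (n - (i : ℝ))

end ExpHardy

end

noncomputable section

namespace ExpHardy

/-! Put `m = n - 1`. The inequality is an optimal control problem with control `w = u'`. Its reduced
state `S = n ∫₀^r e^{n(u - t)} dt · e^{-n(u(r) - r)}` satisfies `S' = n - n (w - 1) S`, and the
logarithm of the truncated integral is `n (u - r) + log S`. The function `bellman m` is an explicit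
solution of the associated Hamilton–Jacobi–Bellman equation. With the parameter `y = 1/σ`, where `S
= stateMap m σ` for `S ≥ m` and `σ = 1` for `S ≤ m`, its derivative `B'` satisfies `1 - S B' = y^m`
and `B' = y^m - y^{m+1}`. Hence `n (u - r) + B(S)` minus the weighted energy has derivative `n w y^m
- n y^{m+1} - c |w|^n`, nonpositive by Young's inequality (`young_le`, `antitone_pathValue`). It
starts at `slopeInt m 1`, which is `C_n` (`sharpConst_eq`), and `log_le_bellman` bounds the integral
by it.

Equality would force `w = n/m` forever, since this control keeps `S < m`; the energy would then be
infinite. `exists_pathValue_lt` turns any departure into a definite loss, which survives the limit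
`r → ∞`.

For sharpness, the paths `bubble (n/m) b` approximate that unattained extremal as `b → 0`. Both
integrals are explicit: the defect, log minus weighted energy, equals `slopeInt m (1 + b)⁻¹`. -/

/-! ### The additive constant as a generalised harmonic number -/

/-- The slope `(1 - y ^ m) / (1 - y)` of `y ↦ y ^ m` between `y` and `1`. -/
def slopeRpow (m : ℝ) : ℝ → ℝ := dslope (fun x : ℝ => x ^ m) 1

/-- The primitive of `slopeRpow m`; its value at `1` is the harmonic number `H_m`. -/
def slopeInt (m y : ℝ) : ℝ := ∫ t in (0 : ℝ)..y, slopeRpow m t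

lemma slopeRpow_of_ne (m : ℝ) {y : ℝ} (hy : y ≠ 1) :
    slopeRpow m y = (y ^ m - 1) / (y - 1) := by
  simp [slopeRpow, dslope_of_ne _ hy, slope_def_field]

lemma slopeRpow_one (m : ℝ) : slopeRpow m 1 = m := by
  have := (Real.hasDerivAt_rpow_const (x := 1) (p := m) (Or.inl one_ne_zero)).deriv
  simp [slopeRpow, this]

lemma continuous_slopeRpow {m : ℝ} (hm : 0 ≤ m) : Continuous (slopeRpow m) := by
  rw [← continuousOn_univ]
  refine (continuousOn_dslope Filter.univ_mem).2 ⟨?_, ?_⟩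
  · exact (Real.continuous_rpow_const hm).continuousOn
  · exact (Real.hasDerivAt_rpow_const (Or.inl one_ne_zero)).differentiableAt

lemma hasDerivAt_slopeInt {m : ℝ} (hm : 0 ≤ m) (y : ℝ) :
    HasDerivAt (slopeInt m) (slopeRpow m y) y :=
  ((continuous_slopeRpow hm).integral_hasStrictDerivAt 0 y).hasDerivAt

lemma slopeInt_zero (m : ℝ) : slopeInt m 0 = 0 := by simp [slopeInt]

lemma integral_one_div_mul_one_sub_rpow (m : ℝ) :
    (∫ t in (0 : ℝ)..1, 1 / t * (1 - (1 - t) ^ m)) = slopeInt m 1 := by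
  have h := intervalIntegral.integral_comp_sub_left (a := (0 : ℝ)) (b := 1)
    (fun y : ℝ => 1 / (1 - y) * (1 - y ^ m)) 1
  simp only [sub_sub_cancel, sub_self, sub_zero] at h
  rw [h, slopeInt]
  refine intervalIntegral.integral_congr_ae ?_
  have h1 : ∀ᵐ y : ℝ, y ≠ 1 := by simp [ae_iff]
  filter_upwards [h1] with y hy _
  rw [slopeRpow_of_ne m hy, ← neg_div_neg_eq (y ^ m - 1), neg_sub, neg_sub]
  ring

/-- Since `(1 - t^{m+1}) - (1 - t^m) = t^m (1 - t)`, the two slopes differ by `t^m`. -/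
lemma slopeInt_add_one {m : ℝ} (hm : 0 ≤ m) :
    slopeInt (m + 1) 1 = slopeInt m 1 + 1 / (m + 1) := by
  have h : ∫ t in (0 : ℝ)..1, (slopeRpow (m + 1) t - slopeRpow m t) = ∫ t in (0 : ℝ)..1, t ^ m := by
    refine intervalIntegral.integral_congr_ae ?_
    have h1 : ∀ᵐ y : ℝ, y ≠ 1 := by simp [ae_iff]
    filter_upwards [h1] with y hy hy0
    rw [uIoc_of_le zero_le_one] at hy0
    rw [slopeRpow_of_ne _ hy, slopeRpow_of_ne _ hy, Real.rpow_add_one hy0.1.ne', ← sub_div,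
      div_eq_iff (sub_ne_zero.2 hy)]
    ring
  rw [intervalIntegral.integral_sub ((continuous_slopeRpow (by linarith)).intervalIntegrable _ _)
    ((continuous_slopeRpow hm).intervalIntegrable _ _),
    integral_rpow (Or.inl (by linarith)), Real.one_rpow,
    Real.zero_rpow (by linarith), sub_zero] at h
  simp only [slopeInt]
  linarith

lemma slopeInt_sub_nat (n : ℝ) (j : ℕ) (hj : (j : ℝ) ≤ n - 1) :
    slopeInt (n - 1) 1 = slopeInt (n - 1 - j) 1 + ∑ i ∈ Finset.Icc 1 j, 1 / (n - (i : ℝ)) := by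
  induction j with
  | zero => simp
  | succ j ih =>
    push_cast at hj
    rw [ih (by linarith), Finset.sum_Icc_succ_top (by omega)]
    have := slopeInt_add_one (m := n - 1 - ((j + 1 : ℕ) : ℝ)) (by push_cast; linarith)
    rw [show n - 1 - ((j + 1 : ℕ) : ℝ) + 1 = n - 1 - j by push_cast; ring] at this
    rw [this, show n - 1 - (j : ℝ) = n - ((j + 1 : ℕ) : ℝ) by push_cast; ring]
    ring

/-- Removing `⌊n⌋₊ - 1` terms by the harmonic recurrence leaves the exponent `n - ⌊n⌋₊`, which may
be `0`. -/
lemma sharpConst_eq {n : ℝ} (hn : 1 < n) : sharpConst n = slopeInt (n - 1) 1 := by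
  have h1 : 1 ≤ ⌊n⌋₊ := Nat.le_floor (by simpa using hn.le)
  have h2 : (⌊n⌋₊ : ℝ) ≤ n := Nat.floor_le (by linarith)
  rw [sharpConst, integral_one_div_mul_one_sub_rpow,
    slopeInt_sub_nat n (⌊n⌋₊ - 1) (by push_cast [Nat.cast_sub h1]; linarith)]
  congr 2
  push_cast [Nat.cast_sub h1]; ring

lemma slopeRpow_pos {m y : ℝ} (hm : 0 < m) (hy : 0 ≤ y) : 0 < slopeRpow m y := by
  rcases lt_trichotomy y 1 with h | rfl | h
  · rw [slopeRpow_of_ne m h.ne]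
    exact div_pos_of_neg_of_neg (by linarith [Real.rpow_lt_one hy h hm]) (by linarith)
  · rwa [slopeRpow_one]
  · rw [slopeRpow_of_ne m h.ne']
    exact div_pos (by linarith [Real.one_lt_rpow h hm]) (by linarith)

lemma mul_one_sub_rpow_le {m y : ℝ} (hm : 0 < m) (hy : 0 < y) :
    y * (1 - y ^ m) ≤ m * (1 - y) := by
  have h1 := Real.one_sub_inv_le_log_of_pos hy
  have h2 := Real.add_one_le_exp (Real.log y * m)
  rw [← Real.rpow_def_of_pos hy] at h2
  have h3 : 1 - y ^ m ≤ m * (y⁻¹ - 1) := by nlinarith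
  calc y * (1 - y ^ m) ≤ y * (m * (y⁻¹ - 1)) := by gcongr
    _ = m * (1 - y) := by field_simp

/-- Both sides vanish at `0`. With `f = slopeRpow m`, the difference has derivative `f - f'/f`, and
`f' ≤ f^2` reduces to `mul_one_sub_rpow_le`. -/
lemma log_slopeRpow_le {m y : ℝ} (hm : 0 < m) (hy : 0 ≤ y) (hy1 : y ≤ 1) :
    Real.log (slopeRpow m y) ≤ slopeInt m y := by
  have hmono : MonotoneOn (fun y => slopeInt m y - Real.log (slopeRpow m y)) (Icc 0 1) := by
    have hd : ∀ x ∈ Ioo (0 : ℝ) 1, HasDerivAt (fun y => slopeInt m y - Real.log (slopeRpow m y))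
        (slopeRpow m x - ((m * x ^ (m - 1)) * (x - 1) - (x ^ m - 1) * 1) / (x - 1) ^ 2
          / slopeRpow m x) x := by
      intro x hx
      have e : slopeRpow m =ᶠ[nhds x] fun y => (y ^ m - 1) / (y - 1) := by
        filter_upwards [isOpen_ne.mem_nhds hx.2.ne] with z hz using slopeRpow_of_ne m hz
      have d1 := ((Real.hasDerivAt_rpow_const (p := m) (Or.inl hx.1.ne')).sub_const 1).div
        ((hasDerivAt_id x).sub_const 1) (sub_ne_zero.2 hx.2.ne)
      have d2 := HasDerivAt.congr_of_eventuallyEq d1 e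
      exact (hasDerivAt_slopeInt hm.le x).sub (d2.log (slopeRpow_pos hm hx.1.le).ne')
    refine monotoneOn_of_deriv_nonneg (convex_Icc 0 1) ?_ ?_ ?_
    · refine ContinuousOn.sub (fun x _ => (hasDerivAt_slopeInt hm.le x).continuousAt.continuousWithinAt) ?_
      exact (continuous_slopeRpow hm.le).continuousOn.log fun x hx => (slopeRpow_pos hm hx.1).ne'
    · rw [interior_Icc]
      exact fun x hx => (hd x hx).differentiableAt.differentiableWithinAt
    · rw [interior_Icc]
      intro x hx
      rw [(hd x hx).deriv, sub_nonneg, div_le_iff₀ (slopeRpow_pos hm hx.1.le),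
        slopeRpow_of_ne m hx.2.ne, div_mul_div_comm, ← sq (x - 1), Real.rpow_sub_one hx.1.ne']
      have h3 : 0 < (x - 1) ^ 2 := by nlinarith [hx.2]
      refine div_le_div_of_nonneg_right ?_ h3.le
      have h4 := mul_one_sub_rpow_le hm hx.1
      have h5 : 0 < x ^ m := Real.rpow_pos_of_pos hx.1 m
      have h6 : x ^ m * (1 - x ^ m) ≤ m * (x ^ m / x) * (1 - x) := by
        calc x ^ m * (1 - x ^ m) = x ^ m / x * (x * (1 - x ^ m)) := by
              field_simp [hx.1.ne']
          _ ≤ x ^ m / x * (m * (1 - x)) :=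
              mul_le_mul_of_nonneg_left h4 (div_pos h5 hx.1).le
          _ = _ := by ring
      nlinarith
  have := hmono ⟨le_rfl, zero_le_one⟩ ⟨hy, hy1⟩ hy
  have h0 : slopeRpow m 0 = 1 := by
    rw [slopeRpow_of_ne m zero_ne_one, Real.zero_rpow hm.ne']; norm_num
  simp only [h0, slopeInt_zero, Real.log_one] at this
  linarith

/-! ### Parametrisation of the state and its inverse -/

/-- `σ ↦ (σ ^ (m + 1) - σ) / (σ - 1)`. -/
def stateMap (m σ : ℝ) : ℝ := σ * slopeRpow m σ

lemma continuous_stateMap {m : ℝ} (hm : 0 ≤ m) : Continuous (stateMap m) :=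
  continuous_id.mul (continuous_slopeRpow hm)

lemma stateMap_one (m : ℝ) : stateMap m 1 = m := by simp [stateMap, slopeRpow_one]

lemma stateMap_of_ne (m : ℝ) {σ : ℝ} (h : σ ≠ 1) :
    stateMap m σ = σ * (σ ^ m - 1) / (σ - 1) := by
  rw [stateMap, slopeRpow_of_ne m h, mul_div_assoc]

lemma hasDerivAt_stateMap (m : ℝ) {σ : ℝ} (h : 1 < σ) :
    HasDerivAt (stateMap m)
      ((m * (σ ^ m * σ) - (m + 1) * σ ^ m + 1) / (σ - 1) ^ 2) σ := by
  have hσ : σ ≠ 0 := by linarith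
  have e : stateMap m =ᶠ[nhds σ] fun y => y * (y ^ m - 1) / (y - 1) := by
    filter_upwards [isOpen_ne.mem_nhds h.ne'] with z hz using stateMap_of_ne m hz
  have d1 := ((hasDerivAt_id σ).mul
    ((Real.hasDerivAt_rpow_const (p := m) (Or.inl hσ)).sub_const 1)).div
        ((hasDerivAt_id σ).sub_const 1) (sub_ne_zero.2 h.ne')
  refine (HasDerivAt.congr_of_eventuallyEq d1 e).congr_deriv ?_
  congr 1
  simp only [id, Real.rpow_sub_one hσ, Pi.mul_apply]
  field_simp
  ring

/-- Strict Bernoulli for `(σ⁻¹)^{m+1}`, multiplied by `σ^{m+1}`. -/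
lemma stateMap_deriv_num_pos {m σ : ℝ} (hm : 0 < m) (h : 1 < σ) :
    0 < m * (σ ^ m * σ) - (m + 1) * σ ^ m + 1 := by
  have hσ : 0 < σ := by linarith
  have hi : σ⁻¹ < 1 := inv_lt_one_of_one_lt₀ h
  have hi0 : 0 < σ⁻¹ := inv_pos.2 hσ
  have := one_add_mul_self_lt_rpow_one_add (s := σ⁻¹ - 1) (p := m + 1) (by linarith)
    (by linarith) (by linarith)
  rw [add_sub_cancel, Real.inv_rpow hσ.le, Real.rpow_add_one hσ.ne'] at this
  have hq : 0 < σ ^ m := Real.rpow_pos_of_pos hσ m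
  have h2 := mul_lt_mul_of_pos_right this (mul_pos hq hσ)
  rw [inv_mul_cancel₀ (mul_pos hq hσ).ne'] at h2
  have h3 : (1 + (m + 1) * (σ⁻¹ - 1)) * (σ ^ m * σ) =
      σ ^ m * σ + (m + 1) * (σ ^ m - σ ^ m * σ) := by
    field_simp
  rw [h3] at h2
  linarith

lemma strictMonoOn_stateMap {m : ℝ} (hm : 0 < m) : StrictMonoOn (stateMap m) (Ici 1) := by
  refine strictMonoOn_of_deriv_pos (convex_Ici 1) (continuous_stateMap hm.le).continuousOn ?_
  rw [interior_Ici]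
  intro σ hσ
  rw [(hasDerivAt_stateMap m hσ).deriv]
  have : (0:ℝ) < σ - 1 := sub_pos.2 hσ
  exact div_pos (stateMap_deriv_num_pos hm hσ) (by positivity)

/-- A strictly increasing continuous extension of `stateMap m` from `[1, ∞)` to the line. -/
def stateMapExt (m σ : ℝ) : ℝ := stateMap m (max σ 1) + min (σ - 1) 0

lemma strictMono_stateMapExt {m : ℝ} (hm : 0 < m) : StrictMono (stateMapExt m) := by
  intro a b hab
  simp only [stateMapExt]
  rcases le_total b 1 with hb | hb
  · rw [max_eq_right (hab.le.trans hb), max_eq_right hb, min_eq_left (by linarith),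
      min_eq_left (by linarith)]
    linarith
  · have h1 : min (b - 1) 0 = 0 := min_eq_right (by linarith)
    rcases le_or_gt a 1 with ha | ha
    · have h3 : stateMap m (max a 1) ≤ stateMap m (max b 1) :=
        (strictMonoOn_stateMap hm).monotoneOn (mem_Ici.2 (le_max_right _ _))
          (mem_Ici.2 (le_max_right _ _)) (max_le_max_right _ hab.le)
      rcases ha.lt_or_eq with ha' | rfl
      · rw [h1, min_eq_left (by linarith)]; linarith
      · rw [h1, max_self, max_eq_left hb]
        simpa using strictMonoOn_stateMap hm (mem_Ici.2 le_rfl) hb hab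
    · rw [h1, min_eq_right (by linarith), max_eq_left ha.le, max_eq_left hb]
      simpa using strictMonoOn_stateMap hm (mem_Ici.2 ha.le) (mem_Ici.2 hb) hab

lemma continuous_stateMapExt {m : ℝ} (hm : 0 ≤ m) : Continuous (stateMapExt m) :=
  ((continuous_stateMap hm).comp (by fun_prop)).add (by fun_prop)

lemma surjective_stateMapExt {m : ℝ} (hm : 0 < m) : Function.Surjective (stateMapExt m) := by
  refine (continuous_stateMapExt hm.le).surjective ?_ ?_
  · refine Filter.tendsto_atTop_mono' _ ?_
      (Filter.tendsto_atTop_add_const_right _ (-1) (tendsto_rpow_atTop hm))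
    filter_upwards [Filter.eventually_gt_atTop 1] with σ hσ
    have hq := Real.one_lt_rpow hσ hm
    rw [stateMapExt, max_eq_left hσ.le, min_eq_right (by linarith), stateMap_of_ne m hσ.ne',
      add_zero, le_div_iff₀ (by linarith)]
    nlinarith
  · refine Filter.tendsto_atBot_mono' _ ?_
      (Filter.tendsto_atBot_add_const_right _ (m - 1) Filter.tendsto_id)
    filter_upwards [Filter.eventually_lt_atBot 1] with σ hσ
    rw [stateMapExt, max_eq_right hσ.le, stateMap_one, min_eq_left (by linarith)]
    simp only [id]; linarith

/-- The inverse of `stateMap m` on `[m, ∞)`, extended by `1`. -/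
def stateInv (m S : ℝ) : ℝ := max 1 (Function.invFun (stateMapExt m) S)

lemma stateMapExt_invFun {m : ℝ} (hm : 0 < m) (S : ℝ) :
    stateMapExt m (Function.invFun (stateMapExt m) S) = S :=
  Function.rightInverse_invFun (surjective_stateMapExt hm) S

lemma continuous_stateInv {m : ℝ} (hm : 0 < m) : Continuous (stateInv m) := by
  let e := (strictMono_stateMapExt hm).orderIsoOfSurjective _ (surjective_stateMapExt hm)
  have he : Function.invFun (stateMapExt m) = e.symm := by
    ext S
    apply (strictMono_stateMapExt hm).injective
    rw [stateMapExt_invFun hm]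
    exact (e.apply_symm_apply S).symm
  have : stateInv m = fun S => max 1 (e.symm S) := by
    ext S; rw [stateInv, he]
  rw [this]
  exact continuous_const.max e.symm.continuous

lemma one_le_stateInv (m S : ℝ) : 1 ≤ stateInv m S := le_max_left _ _

lemma stateInv_of_le {m S : ℝ} (hm : 0 < m) (hS : S ≤ m) : stateInv m S = 1 := by
  refine max_eq_left ?_
  rw [← (strictMono_stateMapExt hm).le_iff_le, stateMapExt_invFun hm]
  simpa [stateMapExt, stateMap_one] using hS

lemma one_lt_stateInv {m S : ℝ} (hm : 0 < m) (hS : m < S) : 1 < stateInv m S := by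
  refine lt_max_of_lt_right ?_
  rw [← (strictMono_stateMapExt hm).lt_iff_lt, stateMapExt_invFun hm]
  simpa [stateMapExt, stateMap_one] using hS

lemma stateMap_stateInv {m S : ℝ} (hm : 0 < m) (hS : m ≤ S) :
    stateMap m (stateInv m S) = S := by
  have h1 : 1 ≤ Function.invFun (stateMapExt m) S := by
    rw [← (strictMono_stateMapExt hm).le_iff_le, stateMapExt_invFun hm]
    simpa [stateMapExt, stateMap_one] using hS
  have h2 := stateMapExt_invFun hm S
  rw [stateMapExt, max_eq_left h1, min_eq_right (by linarith), add_zero] at h2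
  rw [stateInv, max_eq_right h1, h2]

/-! ### The Bellman function -/

/-- The value function of the extremal problem in the reduced state `S`. -/
def bellman (m S : ℝ) : ℝ :=
  m * Real.log (stateInv m S) + slopeInt m (stateInv m S)⁻¹

/-- The derivative of `bellman m`. -/
def bellmanDeriv (m S : ℝ) : ℝ :=
  (stateInv m S - 1) / (stateInv m S ^ m * stateInv m S)

lemma continuous_bellmanDeriv {m : ℝ} (hm : 0 < m) : Continuous (bellmanDeriv m) := by
  have hp : ∀ S, 0 < stateInv m S := fun S => zero_lt_one.trans_le (one_le_stateInv m S)
  refine ((continuous_stateInv hm).sub continuous_const).div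
    (((Real.continuous_rpow_const hm.le).comp (continuous_stateInv hm)).mul
      (continuous_stateInv hm)) fun S => ?_
  exact (mul_pos (Real.rpow_pos_of_pos (hp S) m) (hp S)).ne'

lemma continuous_bellman {m : ℝ} (hm : 0 < m) : Continuous (bellman m) := by
  have hp : ∀ S, stateInv m S ≠ 0 := fun S =>
    (zero_lt_one.trans_le (one_le_stateInv m S)).ne'
  have hc : Continuous (slopeInt m) :=
    continuous_iff_continuousAt.2 fun y => (hasDerivAt_slopeInt hm.le y).continuousAt
  exact (continuous_const.mul ((continuous_stateInv hm).log hp)).add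
    (hc.comp ((continuous_stateInv hm).inv₀ hp))

lemma bellman_of_le {m S : ℝ} (hm : 0 < m) (hS : S ≤ m) : bellman m S = slopeInt m 1 := by
  simp [bellman, stateInv_of_le hm hS]

lemma slopeRpow_inv (m : ℝ) {σ : ℝ} (h : 1 < σ) :
    slopeRpow m σ⁻¹ = σ * (σ ^ m - 1) / (σ ^ m * (σ - 1)) := by
  have hσ : 0 < σ := by linarith
  have hq : 0 < σ ^ m := Real.rpow_pos_of_pos hσ m
  have h1 : σ - 1 ≠ 0 := sub_ne_zero.2 h.ne'
  have h2 : 1 - σ ≠ 0 := sub_ne_zero.2 h.ne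
  rw [slopeRpow_of_ne m (inv_lt_one_of_one_lt₀ h).ne, Real.inv_rpow hσ.le]
  rw [div_eq_div_iff (by field_simp; exact div_ne_zero h2 hσ.ne') (by positivity)]
  field_simp
  ring

lemma hasDerivAt_bellman_of_gt {m S : ℝ} (hm : 0 < m) (hS : m < S) :
    HasDerivAt (bellman m) (bellmanDeriv m S) S := by
  have h1 := one_lt_stateInv hm hS
  have hinv : HasDerivAt (stateInv m) _ S :=
    HasDerivAt.of_local_left_inverse (continuous_stateInv hm).continuousAt
      (hasDerivAt_stateMap m h1)
      (div_pos (stateMap_deriv_num_pos hm h1) (pow_pos (sub_pos.2 h1) 2)).ne'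
      (by filter_upwards [Ioi_mem_nhds hS] with T hT using stateMap_stateInv hm (le_of_lt hT))
  have hnum := stateMap_deriv_num_pos hm h1
  have hpos : 0 < stateInv m S := by linarith
  have hd : HasDerivAt (bellman m) _ S := ((hinv.log hpos.ne').const_mul m).add
    ((hasDerivAt_slopeInt hm.le _).comp S (hinv.inv hpos.ne'))
  refine hd.congr_deriv ?_
  rw [slopeRpow_inv m h1, bellmanDeriv]
  generalize stateInv m S = σ at *
  have hq : 0 < σ ^ m := Real.rpow_pos_of_pos hpos m
  generalize σ ^ m = q at *
  have h2 : σ - 1 ≠ 0 := sub_ne_zero.2 h1.ne'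
  obtain ⟨d, hd⟩ : ∃ d, d = m * (q * σ) - (m + 1) * q + 1 := ⟨_, rfl⟩
  rw [← hd] at hnum ⊢
  field_simp
  linear_combination -hd

/-- At the junction `S = m` the parametrisation degenerates; there the derivative comes from
continuity of `bellman m` and `bellmanDeriv m`. -/
lemma hasDerivAt_bellman {m : ℝ} (hm : 0 < m) (S : ℝ) :
    HasDerivAt (bellman m) (bellmanDeriv m S) S := by
  have hne : ∀ S, S ≠ m → HasDerivAt (bellman m) (bellmanDeriv m S) S := by
    intro S hS
    rcases hS.lt_or_gt with h | h
    · have e : bellman m =ᶠ[nhds S] fun _ => slopeInt m 1 := by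
        filter_upwards [Iio_mem_nhds h] with T hT using bellman_of_le hm (le_of_lt hT)
      have := (hasDerivAt_const S (slopeInt m 1)).congr_of_eventuallyEq e
      simpa [bellmanDeriv, stateInv_of_le hm h.le] using this
    · exact hasDerivAt_bellman_of_gt hm h
  by_cases h : S = m
  · subst h
    exact hasDerivAt_of_hasDerivAt_of_ne hne (continuous_bellman hm).continuousAt
      (continuous_bellmanDeriv hm).continuousAt
  · exact hne S h

/-- For `S > m`, `S = σ^m · slopeRpow m σ⁻¹`, so `log_slopeRpow_le` at `σ⁻¹` suffices. For `S ≤ m`,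
`log S ≤ log m` and the same bound is used at `1`. -/
lemma log_le_bellman {m S : ℝ} (hm : 0 < m) (hS : 0 < S) : Real.log S ≤ bellman m S := by
  rcases le_or_gt S m with h | h
  · rw [bellman_of_le hm h]
    have := log_slopeRpow_le hm zero_le_one le_rfl
    rw [slopeRpow_one] at this
    exact (Real.log_le_log hS h).trans this
  · have h1 := one_lt_stateInv hm h
    have hpos : 0 < stateInv m S := by linarith
    have hi := inv_pos.2 hpos
    have hq := Real.rpow_pos_of_pos hpos m
    have h2 : S = stateInv m S ^ m * slopeRpow m (stateInv m S)⁻¹ := by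
      conv_lhs => rw [← stateMap_stateInv hm h.le, stateMap_of_ne m h1.ne']
      rw [slopeRpow_inv m h1]
      have := sub_pos.2 h1
      field_simp
    have h3 := log_slopeRpow_le hm hi.le (inv_lt_one_of_one_lt₀ h1).le
    conv_lhs => rw [h2]
    rw [Real.log_mul hq.ne' (slopeRpow_pos hm hi.le).ne', Real.log_rpow hpos, bellman]
    linarith

lemma mul_bellmanDeriv {m S : ℝ} (hm : 0 < m) :
    S * bellmanDeriv m S = 1 - ((stateInv m S)⁻¹) ^ m := by
  rcases le_or_gt S m with h | h
  · simp [bellmanDeriv, stateInv_of_le hm h]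
  · have h1 := one_lt_stateInv hm h
    have hpos : 0 < stateInv m S := by linarith
    have hq := Real.rpow_pos_of_pos hpos m
    have h2 := sub_pos.2 h1
    rw [bellmanDeriv, Real.inv_rpow hpos.le]
    nth_rewrite 1 [← stateMap_stateInv hm h.le]
    rw [stateMap_of_ne m h1.ne']
    field_simp

lemma bellmanDeriv_eq (m S : ℝ) :
    bellmanDeriv m S = ((stateInv m S)⁻¹) ^ m - ((stateInv m S)⁻¹) ^ (m + 1) := by
  have hpos : 0 < stateInv m S := zero_lt_one.trans_le (one_le_stateInv m S)
  have hq := Real.rpow_pos_of_pos hpos m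
  rw [bellmanDeriv, Real.rpow_add_one (inv_ne_zero hpos.ne'), Real.inv_rpow hpos.le]
  field_simp

/-! ### Young's inequality with the sharp coefficient -/

lemma add_one_mul_lt_add_abs_rpow {m z : ℝ} (hm : 0 < m) (hz : z ≠ 1) :
    (m + 1) * z < m + |z| ^ (m + 1) := by
  rcases le_or_gt 0 z with h | h
  · have := one_add_mul_self_lt_rpow_one_add (s := z - 1) (p := m + 1) (by linarith)
      (sub_ne_zero.2 hz) (by linarith)
    rw [add_sub_cancel] at this
    rw [abs_of_nonneg h]; linarith
  · have := Real.rpow_nonneg (abs_nonneg z) (m + 1)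
    nlinarith

lemma sharpCoeff_add_one (m : ℝ) : sharpCoeff (m + 1) = (m / (m + 1)) ^ m := by
  rw [sharpCoeff, add_sub_cancel_right]

lemma sharpCoeff_pos {n : ℝ} (hn : 1 < n) : 0 < sharpCoeff n :=
  Real.rpow_pos_of_pos (div_pos (by linarith) (by linarith)) _

lemma sharpCoeff_mul_rpow {m : ℝ} (hm : 0 < m) :
    sharpCoeff (m + 1) * ((m + 1) / m) ^ m = 1 := by
  rw [sharpCoeff_add_one, ← Real.mul_rpow (by positivity) (by positivity)]
  rw [div_mul_div_comm, mul_comm, div_self (by positivity), Real.one_rpow]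

/-- Scaling `w = ((m + 1)/m) y z` reduces this to Bernoulli in `z`; `sharpCoeff_mul_rpow` is exactly
what makes the coefficients match. -/
lemma young_lt {m w y : ℝ} (hm : 0 < m) (hy : 0 < y) (hw : w ≠ (m + 1) / m * y) :
    (m + 1) * w * y ^ m < (m + 1) * y ^ (m + 1) + sharpCoeff (m + 1) * |w| ^ (m + 1) := by
  have hk : 0 < (m + 1) / m := by positivity
  obtain ⟨z, rfl⟩ : ∃ z, w = (m + 1) / m * y * z :=
    ⟨w / ((m + 1) / m * y), by field_simp⟩
  have hz : z ≠ 1 := by rintro rfl; exact hw (mul_one _)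
  have h1 := add_one_mul_lt_add_abs_rpow hm hz
  have hq := Real.rpow_pos_of_pos hy m
  have h2 := mul_lt_mul_of_pos_left h1 (mul_pos (mul_pos hk hq) hy)
  have h3 : sharpCoeff (m + 1) * |(m + 1) / m * y * z| ^ (m + 1) =
      (m + 1) / m * y ^ m * y * |z| ^ (m + 1) := by
    rw [abs_mul, abs_of_pos (mul_pos hk hy), Real.mul_rpow (by positivity) (abs_nonneg z),
      Real.mul_rpow hk.le hy.le, Real.rpow_add_one hk.ne', Real.rpow_add_one hy.ne']
    linear_combination (m + 1) / m * y ^ m * y * |z| ^ (m + 1) * sharpCoeff_mul_rpow hm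
  rw [h3, Real.rpow_add_one hy.ne']
  have h4 : (m + 1) / m * y ^ m * y * (m + |z| ^ (m + 1)) =
      (m + 1) * (y ^ m * y) + (m + 1) / m * y ^ m * y * |z| ^ (m + 1) := by
    field_simp
  rw [h4] at h2
  linarith

lemma young_le {m w y : ℝ} (hm : 0 < m) (hy : 0 < y) :
    (m + 1) * w * y ^ m ≤ (m + 1) * y ^ (m + 1) + sharpCoeff (m + 1) * |w| ^ (m + 1) := by
  by_cases hw : w = (m + 1) / m * y
  · have hk : 0 < (m + 1) / m := by positivity
    rw [hw, abs_of_pos (mul_pos hk hy), Real.mul_rpow hk.le hy.le, Real.rpow_add_one hk.ne',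
      Real.rpow_add_one hy.ne']
    have : sharpCoeff (m + 1) * (((m + 1) / m) ^ m * ((m + 1) / m) * (y ^ m * y)) =
        (m + 1) / m * (y ^ m * y) := by
      linear_combination (m + 1) / m * y ^ m * y * sharpCoeff_mul_rpow hm
    rw [this]
    apply le_of_eq
    field_simp
  · exact (young_lt hm hy hw).le

/-! ### Monotonicity of the value along a path -/

/-- The truncated exponential integral. -/
def partialExp (n : ℝ) (U : ℝ → ℝ) (r : ℝ) : ℝ := ∫ t in (0 : ℝ)..r, Real.exp (n * (U t - t))

/-- The truncated energy of a function with derivative `w`. -/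
def partialEnergy (n : ℝ) (w : ℝ → ℝ) (r : ℝ) : ℝ := ∫ t in (0 : ℝ)..r, |w t| ^ n

/-- The reduced state of the path `U` at time `r`. -/
def pathState (n : ℝ) (U : ℝ → ℝ) (r : ℝ) : ℝ :=
  n * partialExp n U r * Real.exp (-(n * (U r - r)))

/-- The quantity which decreases along every path. -/
def pathValue (m : ℝ) (U w : ℝ → ℝ) (r : ℝ) : ℝ :=
  (m + 1) * (U r - r) + bellman m (pathState (m + 1) U r)
    - sharpCoeff (m + 1) * partialEnergy (m + 1) w r

section Path

variable {m : ℝ} {U w : ℝ → ℝ}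

lemma hasDerivAt_partialExp (n : ℝ) (hU : Continuous U) (r : ℝ) :
    HasDerivAt (partialExp n U) (Real.exp (n * (U r - r))) r :=
  ((by fun_prop : Continuous fun t => Real.exp (n * (U t - t))).integral_hasStrictDerivAt
    0 r).hasDerivAt

lemma hasDerivAt_partialEnergy {n : ℝ} (hn : 0 ≤ n) (hw : Continuous w) (r : ℝ) :
    HasDerivAt (partialEnergy n w) (|w r| ^ n) r :=
  ((Real.continuous_rpow_const hn).comp hw.abs).integral_hasStrictDerivAt 0 r |>.hasDerivAt

lemma hasDerivAt_pathState (n : ℝ) (hU : ∀ t, HasDerivAt U (w t) t) (r : ℝ) :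
    HasDerivAt (pathState n U) (n - n * (w r - 1) * pathState n U r) r := by
  have hc : Continuous U := continuous_iff_continuousAt.2 fun t => (hU t).continuousAt
  have h : HasDerivAt (pathState n U) _ r := ((hasDerivAt_partialExp n hc r).const_mul n).mul
    ((((hU r).sub (hasDerivAt_id r)).const_mul n).neg.exp)
  refine h.congr_deriv ?_
  have e : Real.exp (n * (U r - r)) * Real.exp (-(n * (U r - r))) = 1 := by
    rw [← Real.exp_add, add_neg_cancel, Real.exp_zero]
  simp only [pathState, Pi.neg_apply, Pi.sub_apply, id]
  linear_combination n * e

lemma hasDerivAt_pathValue (hm : 0 < m) (hw : Continuous w) (hU : ∀ t, HasDerivAt U (w t) t)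
    (r : ℝ) :
    HasDerivAt (pathValue m U w)
      ((m + 1) * w r * (stateInv m (pathState (m + 1) U r))⁻¹ ^ m -
        ((m + 1) * (stateInv m (pathState (m + 1) U r))⁻¹ ^ (m + 1) +
          sharpCoeff (m + 1) * |w r| ^ (m + 1))) r := by
  have h : HasDerivAt (pathValue m U w) _ r :=
    ((((hU r).sub (hasDerivAt_id r)).const_mul (m + 1)).add
      ((hasDerivAt_bellman hm _).comp r (hasDerivAt_pathState (m + 1) hU r))).sub
      ((hasDerivAt_partialEnergy (by linarith : 0 ≤ m + 1) hw r).const_mul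
        (sharpCoeff (m + 1)))
  refine h.congr_deriv ?_
  have h1 := mul_bellmanDeriv (S := pathState (m + 1) U r) hm
  have h2 := bellmanDeriv_eq m (pathState (m + 1) U r)
  linear_combination (m + 1) * h2 - (m + 1) * (w r - 1) * h1

lemma antitone_pathValue (hm : 0 < m) (hw : Continuous w) (hU : ∀ t, HasDerivAt U (w t) t) :
    Antitone (pathValue m U w) := by
  refine antitone_of_hasDerivAt_nonpos (fun r => hasDerivAt_pathValue hm hw hU r) fun r => ?_
  exact sub_nonpos.2 (young_le hm
    (inv_pos.2 (zero_lt_one.trans_le (one_le_stateInv m _))))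

lemma pathValue_zero (hm : 0 < m) (hU0 : U 0 = 0) : pathValue m U w 0 = slopeInt m 1 := by
  simp [pathValue, pathState, partialExp, partialEnergy, hU0, bellman_of_le hm hm.le]

lemma partialExp_pos (n : ℝ) (hU : Continuous U) {r : ℝ} (hr : 0 < r) :
    0 < partialExp n U r :=
  intervalIntegral.intervalIntegral_pos_of_pos
    ((by fun_prop : Continuous fun t => Real.exp (n * (U t - t))).intervalIntegrable _ _)
    (fun _ => Real.exp_pos _) hr

lemma log_partialExp_le (hm : 0 < m) (hU : Continuous U) {r : ℝ} (hr : 0 < r) :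
    Real.log ((m + 1) * partialExp (m + 1) U r) ≤
      pathValue m U w r + sharpCoeff (m + 1) * partialEnergy (m + 1) w r := by
  have ha : 0 < (m + 1) * partialExp (m + 1) U r :=
    mul_pos (by linarith) (partialExp_pos _ hU hr)
  have h1 := log_le_bellman hm (S := pathState (m + 1) U r) (mul_pos ha (Real.exp_pos _))
  rw [pathState, Real.log_mul ha.ne' (Real.exp_pos _).ne', Real.log_exp] at h1
  simp only [pathValue, pathState]
  linarith

/-- Under this control `S' = ((m + 1)/m)(m - S)`, so `(S - m) e^{(m+1)t/m}` keeps its initial value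
`-m`. -/
lemma pathState_lt_of_optimal (hm : 0 < m) (hU : ∀ t, HasDerivAt U (w t) t) {T : ℝ} (hT : 0 ≤ T)
    (h : ∀ t ∈ Ico 0 T, w t = (m + 1) / m) : pathState (m + 1) U T < m := by
  have hd : ∀ t, HasDerivAt (fun t => (pathState (m + 1) U t - m) * Real.exp ((m + 1) / m * t))
      (((m + 1) - (m + 1) * (w t - 1) * pathState (m + 1) U t) * Real.exp ((m + 1) / m * t) +
        (pathState (m + 1) U t - m) * (Real.exp ((m + 1) / m * t) * ((m + 1) / m * 1))) t :=
    fun t => ((hasDerivAt_pathState (m + 1) hU t).sub_const m).mul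
      ((hasDerivAt_id t).const_mul ((m + 1) / m)).exp
  have hc := constant_of_has_deriv_right_zero
    (f := fun t => (pathState (m + 1) U t - m) * Real.exp ((m + 1) / m * t)) (a := 0) (b := T)
    (fun t _ => (hd t).continuousAt.continuousWithinAt)
    (fun t ht => ((hd t).congr_deriv (by rw [h t ht]; field_simp; ring)).hasDerivWithinAt)
    T ⟨hT, le_rfl⟩
  have h0 : pathState (m + 1) U 0 = 0 := by simp [pathState, partialExp]
  simp only [h0, mul_zero, Real.exp_zero, mul_one] at hc
  by_contra hcon
  have := mul_nonneg (sub_nonneg.2 (not_lt.1 hcon)) (Real.exp_pos ((m + 1) / m * T)).le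
  linarith

lemma exists_pathValue_lt (hm : 0 < m) (hw : Continuous w) (hU : ∀ t, HasDerivAt U (w t) t)
    (hne : ∃ t, 0 ≤ t ∧ w t ≠ (m + 1) / m) :
    ∃ r, 0 < r ∧ pathValue m U w r < pathValue m U w 0 := by
  -- Up to the first departure time `sInf s` the state is below `m`, hence also shortly afterwards.
  -- At a nearby `t ∈ s` the parameter is still `y = 1` while `w t` is not optimal, so Young is
  -- strict.
  set s : Set ℝ := {t | 0 ≤ t ∧ w t ≠ (m + 1) / m} with hs
  have hsne : s.Nonempty := hne
  have hbdd : BddBelow s := ⟨0, fun t ht => ht.1⟩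
  have hT : 0 ≤ sInf s := le_csInf hsne fun t ht => ht.1
  have hlt := pathState_lt_of_optimal hm hU hT fun t ht => by
    by_contra hcon
    exact (csInf_le hbdd (⟨ht.1, hcon⟩ : t ∈ s)).not_gt ht.2
  have hev := ((hasDerivAt_pathState (m + 1) hU (sInf s)).continuousAt).eventually_lt
    continuousAt_const hlt
  obtain ⟨δ, hδ, hball⟩ := Metric.eventually_nhds_iff.1 hev
  obtain ⟨t, hts, htδ⟩ := exists_lt_of_csInf_lt hsne (lt_add_of_pos_right (sInf s) hδ)
  have hle := csInf_le hbdd hts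
  have hSt : pathState (m + 1) U t < m := hball (by
    rw [Real.dist_eq, abs_of_nonneg (by linarith)]; linarith)
  have hd := hasDerivAt_pathValue hm hw hU t
  rw [stateInv_of_le hm hSt.le, inv_one] at hd
  have hneg := young_lt (w := w t) hm zero_lt_one (by rw [mul_one]; exact hts.2)
  have hanti := antitone_pathValue hm hw hU
  refine ⟨t + 1, by linarith [hts.1], ?_⟩
  by_contra hcon
  have hconst : ∀ x ∈ Icc t (t + 1), pathValue m U w x = pathValue m U w t := fun x hx =>
    le_antisymm (hanti hx.1)
      ((hanti hts.1).trans ((not_lt.1 hcon).trans (hanti hx.2)))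
  have hd0 : HasDerivWithinAt (pathValue m U w) 0 (Icc t (t + 1)) t :=
    (hasDerivWithinAt_const t _ (pathValue m U w t)).congr hconst rfl
  have := (uniqueDiffOn_Icc (by linarith : t < t + 1) t ⟨le_rfl, by linarith⟩).eq_deriv _
    hd.hasDerivWithinAt hd0
  linarith

/-- The truncated form of the strict inequality. -/
lemma exists_partialExp_le (hm : 0 < m) (hw : Continuous w) (hU : ∀ t, HasDerivAt U (w t) t)
    (hU0 : U 0 = 0) {E : ℝ} (hE : ∀ r, 0 ≤ r → partialEnergy (m + 1) w r ≤ E) :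
    ∃ D, D < slopeInt m 1 ∧ ∀ r, 0 ≤ r →
      (m + 1) * partialExp (m + 1) U r ≤ Real.exp (D + sharpCoeff (m + 1) * E) := by
  have hc : Continuous U := continuous_iff_continuousAt.2 fun t => (hU t).continuousAt
  -- A path with constant slope `(m + 1)/m` has linearly growing energy; the chosen radius makes it
  -- `E + 1`.
  have hne : ∃ t, 0 ≤ t ∧ w t ≠ (m + 1) / m := by
    by_contra! hcon
    have hk : 0 < ((m + 1) / m) ^ (m + 1) := Real.rpow_pos_of_pos (by positivity) _
    have hE0 : 0 ≤ E := by simpa [partialEnergy] using hE 0 le_rfl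
    have hR : 0 ≤ (E + 1) / ((m + 1) / m) ^ (m + 1) := by positivity
    have h1 := hE _ hR
    have h2 : partialEnergy (m + 1) w ((E + 1) / ((m + 1) / m) ^ (m + 1)) = E + 1 := by
      rw [partialEnergy, intervalIntegral.integral_congr
        (g := fun _ => ((m + 1) / m) ^ (m + 1)) fun t ht => ?_]
      · rw [intervalIntegral.integral_const, smul_eq_mul, sub_zero, div_mul_cancel₀ _ hk.ne']
      · rw [uIcc_of_le hR] at ht
        simp only [hcon t ht.1]
        rw [abs_of_pos (by positivity)]
    linarith
  obtain ⟨r₀, hr₀, hlt⟩ := exists_pathValue_lt hm hw hU hne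
  rw [pathValue_zero hm hU0] at hlt
  refine ⟨_, hlt, fun r hr => ?_⟩
  have hmono : Monotone (partialExp (m + 1) U) :=
    monotone_of_hasDerivAt_nonneg (hasDerivAt_partialExp (m + 1) hc)
      fun _ => (Real.exp_pos _).le
  -- The loss is available only from time `r₀` on; smaller `r` are covered because the truncated
  -- integral increases.
  have hpos : 0 < max r r₀ := lt_max_of_lt_right hr₀
  have hle : (m + 1) * partialExp (m + 1) U (max r r₀) ≤
      Real.exp (pathValue m U w r₀ + sharpCoeff (m + 1) * E) := by
    rw [← Real.log_le_iff_le_exp (mul_pos (by linarith) (partialExp_pos _ hc hpos))]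
    refine (log_partialExp_le (w := w) hm hc hpos).trans ?_
    have hcp := sharpCoeff_pos (n := m + 1) (by linarith)
    exact add_le_add (antitone_pathValue hm hw hU (le_max_right _ _))
      (mul_le_mul_of_nonneg_left (hE _ hpos.le) hcp.le)
  exact (mul_le_mul_of_nonneg_left (hmono (le_max_left _ _)) (by linarith)).trans hle

end Path

/-! ### From truncated integrals to the half-line -/

lemma lintegral_Ioi_le {f : ℝ → ENNReal} {B : ENNReal}
    (h : ∀ r : ℝ, 0 ≤ r → ∫⁻ t in Ioc 0 r, f t ≤ B) : ∫⁻ t in Ioi 0, f t ≤ B := by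
  have hU : Ioi (0 : ℝ) = ⋃ N : ℕ, Ioc 0 (N : ℝ) := by
    ext x
    simp only [mem_Ioi, mem_iUnion, mem_Ioc, exists_and_left]
    exact ⟨fun hx => ⟨hx, exists_nat_ge x⟩, fun hx => hx.1⟩
  rw [hU, setLIntegral_iUnion_of_directed]
  · exact iSup_le fun N => h N N.cast_nonneg
  · exact Monotone.directed_le fun a b hab => Ioc_subset_Ioc_right (by exact_mod_cast hab)

lemma lintegral_Ioc_ofReal {f : ℝ → ℝ} (hf : Continuous f) (h0 : ∀ t, 0 ≤ f t) {r : ℝ}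
    (hr : 0 ≤ r) :
    ∫⁻ t in Ioc 0 r, ENNReal.ofReal (f t) = ENNReal.ofReal (∫ t in (0 : ℝ)..r, f t) := by
  rw [intervalIntegral.integral_of_le hr, ofReal_integral_eq_lintegral_ofReal]
  · exact (hf.integrableOn_Icc (a := 0) (b := r)).mono_set Ioc_subset_Icc_self
  · exact Filter.Eventually.of_forall h0

/-- An admissible function agrees on `[0, ∞)` with a `C¹` function on the line. -/
lemma Admissible.exists_extension {u : ℝ → ℝ} (hu : Admissible u) :
    ∃ U w : ℝ → ℝ, Continuous w ∧ (∀ t, HasDerivAt U (w t) t) ∧ U 0 = 0 ∧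
      (∀ t, 0 ≤ t → U t = u t) ∧ ∀ t, 0 < t → deriv u t = w t := by
  have hcd := hu.contDiffOn.continuousOn_derivWithin (uniqueDiffOn_Ici 0) le_rfl
  -- The one-sided derivative, frozen at its value at `0` for negative times.
  set w : ℝ → ℝ := fun t => derivWithin u (Ici 0) (max t 0) with hwdef
  have hw : Continuous w := hcd.comp_continuous (by fun_prop) fun t => mem_Ici.2 (le_max_right _ _)
  have hd : ∀ t, 0 < t → HasDerivAt u (w t) t := by
    intro t ht
    have h1 := ((hu.contDiffOn.differentiableOn one_ne_zero) t ht.le).hasDerivWithinAt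
    have h2 := h1.hasDerivAt (Ici_mem_nhds ht)
    simpa only [hwdef, max_eq_left ht.le] using h2
  refine ⟨fun t => ∫ x in (0 : ℝ)..t, w x, w, hw,
    fun t => (hw.integral_hasStrictDerivAt 0 t).hasDerivAt, by simp, fun t ht => ?_,
    fun t ht => (hd t ht).deriv⟩
  have := intervalIntegral.integral_eq_sub_of_hasDerivAt_of_le ht
    (hu.contDiffOn.continuousOn.mono Icc_subset_Ici_self) (fun x hx => hd x hx.1)
    (hw.intervalIntegrable _ _)
  simpa [hu.zero] using this

lemma expIntegral_lt {n : ℝ} (hn : 1 < n) {u : ℝ → ℝ} (hu : Admissible u)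
    (hE : energy n u ≠ ⊤) :
    ∃ D, D < sharpConst n ∧ ENNReal.ofReal n * expIntegral n u ≤
      ENNReal.ofReal (Real.exp (D + sharpCoeff n * (energy n u).toReal)) := by
  obtain ⟨U, w, hw, hU, hU0, hUu, huw⟩ := hu.exists_extension
  have hc : Continuous U := continuous_iff_continuousAt.2 fun t => (hU t).continuousAt
  obtain ⟨m, hm, rfl⟩ : ∃ m : ℝ, 0 < m ∧ n = m + 1 := ⟨n - 1, by linarith, by ring⟩
  have henergy : energy (m + 1) u = ∫⁻ r in Ioi (0 : ℝ), ENNReal.ofReal (|w r| ^ (m + 1)) :=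
    setLIntegral_congr_fun measurableSet_Ioi fun t ht => by rw [huw t ht]
  have hexp : expIntegral (m + 1) u =
      ∫⁻ r in Ioi (0 : ℝ), ENNReal.ofReal (Real.exp ((m + 1) * (U r - r))) :=
    setLIntegral_congr_fun measurableSet_Ioi fun t ht => by rw [hUu t (le_of_lt ht)]
  have hP : ∀ r, 0 ≤ r → partialEnergy (m + 1) w r ≤ (energy (m + 1) u).toReal := by
    intro r hr
    rw [← ENNReal.ofReal_le_iff_le_toReal hE, partialEnergy, ← lintegral_Ioc_ofReal
      (f := fun t => |w t| ^ (m + 1)) ((Real.continuous_rpow_const (by linarith)).comp hw.abs)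
      (fun t => Real.rpow_nonneg (abs_nonneg _) _) hr, henergy]
    exact lintegral_mono_set Ioc_subset_Ioi_self
  obtain ⟨D, hD, hle⟩ := exists_partialExp_le hm hw hU hU0 hP
  refine ⟨D, by rwa [sharpConst_eq hn, add_sub_cancel_right], ?_⟩
  rw [hexp, ← lintegral_const_mul' _ _ ENNReal.ofReal_ne_top]
  refine lintegral_Ioi_le fun r hr => ?_
  rw [lintegral_const_mul' _ _ ENNReal.ofReal_ne_top, lintegral_Ioc_ofReal (by fun_prop)
    (fun t => (Real.exp_pos _).le) hr, ← ENNReal.ofReal_mul (by linarith)]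
  exact ENNReal.ofReal_le_ofReal (hle r hr)

/-! ### The nearly extremal family -/

/-- `k r - log ((1 + b e ^ (k r)) / (1 + b))`. -/
def bubble (k b r : ℝ) : ℝ := k * r - Real.log (1 + b * Real.exp (k * r)) + Real.log (1 + b)

/-- The normalised slope of `bubble k b`. -/
def bubbleSlope (k b r : ℝ) : ℝ := (1 + b * Real.exp (k * r))⁻¹

section Bubble

variable {k b : ℝ}

lemma bubbleSlope_pos (hb : 0 < b) (r : ℝ) : 0 < bubbleSlope k b r := by
  unfold bubbleSlope; positivity

lemma bubbleSlope_lt_one (hb : 0 < b) (r : ℝ) : bubbleSlope k b r < 1 :=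
  inv_lt_one_of_one_lt₀ (by have := Real.exp_pos (k * r); nlinarith)

lemma one_sub_bubbleSlope (hb : 0 < b) (r : ℝ) :
    1 - bubbleSlope k b r = b * Real.exp (k * r) * bubbleSlope k b r := by
  unfold bubbleSlope
  have : 0 < 1 + b * Real.exp (k * r) := by positivity
  field_simp
  ring

lemma bubbleSlope_zero : bubbleSlope k b 0 = (1 + b)⁻¹ := by simp [bubbleSlope]

lemma hasDerivAt_bubble (hb : 0 < b) (r : ℝ) :
    HasDerivAt (bubble k b) (k * bubbleSlope k b r) r := by
  have hZ : 0 < 1 + b * Real.exp (k * r) := by positivity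
  have h : HasDerivAt (bubble k b) _ r := ((((hasDerivAt_id r).const_mul k).sub
    (((((hasDerivAt_id r).const_mul k).exp.const_mul b).const_add 1).log hZ.ne')).add_const _)
  refine h.congr_deriv ?_
  simp only [id, bubbleSlope]
  field_simp
  ring

lemma hasDerivAt_bubbleSlope (hb : 0 < b) (r : ℝ) :
    HasDerivAt (bubbleSlope k b) (-(k * bubbleSlope k b r * (1 - bubbleSlope k b r))) r := by
  have hZ : 0 < 1 + b * Real.exp (k * r) := by positivity
  have h : HasDerivAt (bubbleSlope k b) _ r :=
    ((((hasDerivAt_id r).const_mul k).exp.const_mul b).const_add 1).inv hZ.ne'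
  refine h.congr_deriv ?_
  rw [one_sub_bubbleSlope hb]
  simp only [id, bubbleSlope]
  field_simp

lemma tendsto_bubbleSlope (hk : 0 < k) (hb : 0 < b) :
    Filter.Tendsto (bubbleSlope k b) Filter.atTop (nhds 0) := by
  refine Filter.Tendsto.inv_tendsto_atTop ?_
  refine Filter.tendsto_atTop_add_const_left _ 1 (Filter.Tendsto.const_mul_atTop hb ?_)
  exact Real.tendsto_exp_atTop.comp (Filter.tendsto_id.const_mul_atTop hk)

lemma admissible_bubble (hk : 0 < k) (hb : 0 < b) : Admissible (bubble k b) where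
  contDiffOn := by
    have hZ : ∀ r, 1 + b * Real.exp (k * r) ≠ 0 := fun r => by positivity
    refine ContDiff.contDiffOn ?_
    exact ((contDiff_const.mul contDiff_id).sub ((contDiff_const.add
      (contDiff_const.mul (contDiff_const.mul contDiff_id).exp)).log hZ)).add contDiff_const
  nonneg r hr := by
    have h1 : 1 ≤ Real.exp (k * r) := Real.one_le_exp (by positivity)
    have h2 : Real.log (1 + b * Real.exp (k * r)) ≤ Real.log (Real.exp (k * r) * (1 + b)) :=
      Real.log_le_log (by positivity) (by linarith)
    rw [Real.log_mul (by positivity) (by positivity), Real.log_exp] at h2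
    unfold bubble
    linarith
  zero := by simp [bubble]

lemma exp_bubble {m : ℝ} (hm : 0 < m) (hb : 0 < b) (r : ℝ) :
    Real.exp ((m + 1) * (bubble ((m + 1) / m) b r - r)) =
      Real.exp ((m + 1) / m * r) * (1 + b) ^ (m + 1) * bubbleSlope ((m + 1) / m) b r ^ (m + 1) := by
  rw [Real.rpow_def_of_pos (by positivity : 0 < 1 + b),
    Real.rpow_def_of_pos (bubbleSlope_pos hb r), ← Real.exp_add, ← Real.exp_add, bubbleSlope,
    Real.log_inv, bubble]
  congr 1
  field_simp
  ring

lemma lintegral_Ioi_of_hasDerivAt {g g' : ℝ → ℝ} {l : ℝ} (hg : ∀ x, HasDerivAt g (g' x) x)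
    (h0 : ∀ x, 0 ≤ g' x) (hl : Filter.Tendsto g Filter.atTop (nhds l)) :
    ∫⁻ x in Ioi 0, ENNReal.ofReal (g' x) = ENNReal.ofReal (l - g 0) := by
  rw [← integral_Ioi_of_hasDerivAt_of_nonneg' (fun x _ => hg x) (fun x _ => h0 x) hl,
    ofReal_integral_eq_lintegral_ofReal
      (integrableOn_Ioi_deriv_of_nonneg' (fun x _ => hg x) (fun x _ => h0 x) hl)
      (Filter.Eventually.of_forall h0)]

/-- With `Y` the normalised slope and `k = (m + 1)/m`, the integrand is a multiple of `e^{kr}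
Y^{m+1}`, hence of the derivative of `Y^m`, as `Y' = -k Y (1 - Y)`. -/
lemma expIntegral_bubble {m : ℝ} (hm : 0 < m) (hb : 0 < b) :
    ENNReal.ofReal (m + 1) * expIntegral (m + 1) (bubble ((m + 1) / m) b) =
      ENNReal.ofReal ((1 + b) / b) := by
  have hk : 0 < (m + 1) / m := by positivity
  have hd : ∀ r, HasDerivAt
      (fun r => -((1 + b) ^ (m + 1) / b) * bubbleSlope ((m + 1) / m) b r ^ m)
      ((m + 1) * Real.exp ((m + 1) * (bubble ((m + 1) / m) b r - r))) r := by
    intro r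
    have hY := bubbleSlope_pos (k := (m + 1) / m) hb r
    refine (((hasDerivAt_bubbleSlope hb r).rpow_const
      (Or.inl hY.ne')).const_mul _).congr_deriv ?_
    rw [exp_bubble hm hb, one_sub_bubbleSlope hb, Real.rpow_sub_one hY.ne',
      Real.rpow_add_one hY.ne']
    field_simp
  have hl := ((tendsto_bubbleSlope hk hb).rpow_const (p := m) (Or.inr hm.le)).const_mul
    (-((1 + b) ^ (m + 1) / b))
  rw [Real.zero_rpow hm.ne', mul_zero] at hl
  have := lintegral_Ioi_of_hasDerivAt hd (fun r => by positivity) hl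
  simp only [ENNReal.ofReal_mul (by linarith : 0 ≤ m + 1)] at this
  rw [lintegral_const_mul' _ _ ENNReal.ofReal_ne_top] at this
  rw [expIntegral, this]
  congr 1
  have h1 : 0 < 1 + b := by positivity
  have hq := Real.rpow_pos_of_pos h1 m
  simp only [bubbleSlope_zero]
  rw [Real.inv_rpow h1.le, Real.rpow_add_one h1.ne']
  field_simp
  ring

/-- The weighted energy density is `k Y^{m+1}`, with primitive `log (1 - Y) + slopeInt m Y`. -/
lemma energy_bubble {m : ℝ} (hm : 0 < m) (hb : 0 < b) :
    energy (m + 1) (bubble ((m + 1) / m) b) =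
      ENNReal.ofReal ((Real.log ((1 + b) / b) - slopeInt m (1 + b)⁻¹) / sharpCoeff (m + 1)) := by
  have hk : 0 < (m + 1) / m := by positivity
  have hc := sharpCoeff_pos (n := m + 1) (by linarith)
  have hd : ∀ r, HasDerivAt (fun r => (Real.log (1 - bubbleSlope ((m + 1) / m) b r) +
      slopeInt m (bubbleSlope ((m + 1) / m) b r)) / sharpCoeff (m + 1))
      (|deriv (bubble ((m + 1) / m) b) r| ^ (m + 1)) r := by
    intro r
    have hY := bubbleSlope_pos (k := (m + 1) / m) hb r
    have hY1 := bubbleSlope_lt_one (k := (m + 1) / m) hb r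
    have hY' := hasDerivAt_bubbleSlope (k := (m + 1) / m) hb r
    refine (((((hY'.const_sub 1).log (by linarith)).add
      ((hasDerivAt_slopeInt hm.le _).comp r hY')).div_const (sharpCoeff (m + 1)))).congr_deriv ?_
    rw [(hasDerivAt_bubble hb r).deriv, abs_of_pos (mul_pos hk hY), Real.mul_rpow hk.le hY.le,
      slopeRpow_of_ne m hY1.ne, Real.rpow_add_one hk.ne', Real.rpow_add_one hY.ne',
      div_eq_iff hc.ne']
    generalize bubbleSlope ((m + 1) / m) b r = Y at *
    have h1 : 1 - Y ≠ 0 := by linarith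
    have h2 : Y - 1 ≠ 0 := by linarith
    have e : -(-((m + 1) / m * Y * (1 - Y))) / (1 - Y) +
        (Y ^ m - 1) / (Y - 1) * -((m + 1) / m * Y * (1 - Y)) = (m + 1) / m * Y * Y ^ m := by
      field_simp
      ring
    rw [e]
    linear_combination -((m + 1) / m * Y * Y ^ m) * sharpCoeff_mul_rpow hm
  have ht := tendsto_bubbleSlope hk hb
  have hl := ((((ht.const_sub 1).log (by norm_num)).add
    ((hasDerivAt_slopeInt hm.le 0).continuousAt.tendsto.comp ht)).div_const
      (sharpCoeff (m + 1)))
  simp only [sub_zero, Real.log_one, slopeInt_zero, add_zero, zero_div] at hl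
  rw [energy, lintegral_Ioi_of_hasDerivAt hd (fun r => Real.rpow_nonneg (abs_nonneg _) _) hl]
  congr 1
  have h1 : 0 < 1 + b := by positivity
  have h2 : 1 - (1 + b)⁻¹ = ((1 + b) / b)⁻¹ := by field_simp; ring
  simp only [bubbleSlope_zero]
  rw [h2, Real.log_inv]
  ring

end Bubble

/-! ### Extended-real inequalities and optimality -/

lemma monotoneOn_slopeInt {m : ℝ} (hm : 0 < m) : MonotoneOn (slopeInt m) (Ici 0) := by
  refine monotoneOn_of_deriv_nonneg (convex_Ici 0)
    (fun y _ => (hasDerivAt_slopeInt hm.le y).continuousAt.continuousWithinAt)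
    (fun y _ => (hasDerivAt_slopeInt hm.le y).differentiableAt.differentiableWithinAt)
    fun y hy => ?_
  rw [interior_Ici] at hy
  rw [(hasDerivAt_slopeInt hm.le y).deriv]
  exact (slopeRpow_pos hm (le_of_lt hy)).le

lemma log_ofReal_exp (x : ℝ) : ENNReal.log (ENNReal.ofReal (Real.exp x)) = (x : EReal) := by
  rw [ENNReal.log_ofReal_of_pos (Real.exp_pos x), Real.log_exp]

/-- The two integrals along the extremal family. -/
lemma exists_extremal {n b : ℝ} (hn : 1 < n) (hb : 0 < b) :
    ∃ u, Admissible u ∧ ∃ e : ℝ, 0 ≤ e ∧ energy n u = ENNReal.ofReal e ∧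
      sharpCoeff n * e = Real.log ((1 + b) / b) - slopeInt (n - 1) (1 + b)⁻¹ ∧
      ENNReal.log (ENNReal.ofReal n * expIntegral n u) = (Real.log ((1 + b) / b) : ℝ) := by
  obtain ⟨m, hm, rfl⟩ : ∃ m : ℝ, 0 < m ∧ n = m + 1 := ⟨n - 1, by linarith, by ring⟩
  have hc := sharpCoeff_pos hn
  have h1 : 0 < (1 + b) / b := by positivity
  rw [add_sub_cancel_right]
  -- Integrated form of `(1 - y^m)/(1 - y) ≤ 1/(1 - y)`; it makes the energy formula nonnegative, so
  -- `ENNReal.ofReal` does not truncate it.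
  have h2 : slopeInt m (1 + b)⁻¹ ≤ Real.log ((1 + b) / b) := by
    have hcont : ∀ y, ContinuousAt (slopeInt m) y := fun y =>
      (hasDerivAt_slopeInt hm.le y).continuousAt
    have hmono : MonotoneOn (fun y => -Real.log (1 - y) - slopeInt m y) (Ico 0 1) := by
      have hd : ∀ y ∈ Ico (0 : ℝ) 1, HasDerivAt (fun y => -Real.log (1 - y) - slopeInt m y)
          (-(-1 / (1 - y)) - slopeRpow m y) y := fun y hy =>
        (((hasDerivAt_id y).const_sub 1).log (sub_ne_zero.2 hy.2.ne')).neg.sub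
          (hasDerivAt_slopeInt hm.le y)
      refine monotoneOn_of_deriv_nonneg (convex_Ico 0 1)
        (fun y hy => (hd y hy).continuousAt.continuousWithinAt)
        (fun y hy => (hd y (interior_subset hy)).differentiableAt.differentiableWithinAt)
        fun y hy => ?_
      have hy' := interior_subset hy
      rw [(hd y hy').deriv, slopeRpow_of_ne m hy'.2.ne, ← neg_div_neg_eq (y ^ m - 1), neg_sub,
        neg_sub, ← neg_div, neg_neg, ← sub_div]
      have := Real.rpow_nonneg hy'.1 m
      exact div_nonneg (by linarith) (by linarith [hy'.2])
    have hb1 : (1 + b)⁻¹ < 1 := inv_lt_one_of_one_lt₀ (by linarith)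
    have h3 := hmono ⟨le_rfl, zero_lt_one⟩ ⟨by positivity, hb1⟩ (by positivity : 0 ≤ (1 + b)⁻¹)
    have h4 : 1 - (1 + b)⁻¹ = ((1 + b) / b)⁻¹ := by field_simp; ring
    simp only [sub_zero, Real.log_one, neg_zero, slopeInt_zero, h4, Real.log_inv] at h3
    linarith
  refine ⟨bubble ((m + 1) / m) b, admissible_bubble (by positivity) hb, _,
    div_nonneg (sub_nonneg.2 h2) hc.le, energy_bubble hm hb, mul_div_cancel₀ _ hc.ne', ?_⟩
  rw [expIntegral_bubble hm hb, ENNReal.log_ofReal_of_pos h1]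

/-- Here `u ≤ ∫ |u'|` pointwise, and `e^{-r}` has integral `1`. -/
lemma log_expIntegral_one_le {u : ℝ → ℝ} (hu : Admissible u) :
    ENNReal.log (expIntegral 1 u) ≤ (energy 1 u : EReal) := by
  by_cases hE : energy 1 u = ⊤
  · simp [hE]
  obtain ⟨U, w, hw, hU, hU0, hUu, huw⟩ := hu.exists_extension
  have hle : ∀ r, 0 ≤ r → u r ≤ (energy 1 u).toReal := by
    intro r hr
    have h1 : U r ≤ ∫ t in (0 : ℝ)..r, |w t| := by
      have h2 := intervalIntegral.integral_eq_sub_of_hasDerivAt (fun t _ => hU t)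
        (hw.intervalIntegrable 0 r)
      rw [hU0, sub_zero] at h2
      rw [← h2]
      exact intervalIntegral.integral_mono_on hr (hw.intervalIntegrable _ _)
        (hw.abs.intervalIntegrable _ _) fun t _ => le_abs_self _
    rw [← hUu r hr]
    refine h1.trans ?_
    rw [← ENNReal.ofReal_le_iff_le_toReal hE, ← lintegral_Ioc_ofReal hw.abs
      (fun t => abs_nonneg _) hr, energy]
    refine (setLIntegral_congr_fun measurableSet_Ioc fun t ht => ?_).trans_le
      (lintegral_mono_set Ioc_subset_Ioi_self)
    simp only [huw t ht.1, Real.rpow_one]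
  have hd : ∀ r : ℝ, HasDerivAt (fun r => -(Real.exp (energy 1 u).toReal * Real.exp (-r)))
      (Real.exp (energy 1 u).toReal * Real.exp (-r)) r := fun r =>
    (((hasDerivAt_neg r).exp).const_mul _).neg.congr_deriv (by ring)
  have hl : Filter.Tendsto (fun r => -(Real.exp (energy 1 u).toReal * Real.exp (-r)))
      Filter.atTop (nhds 0) := by
    simpa using (Real.tendsto_exp_neg_atTop_nhds_zero.const_mul
      (Real.exp (energy 1 u).toReal)).neg
  have hI := lintegral_Ioi_of_hasDerivAt hd (fun r => by positivity) hl
  simp only [neg_zero, Real.exp_zero, mul_one, zero_sub, neg_neg] at hI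
  have hb : expIntegral 1 u ≤ ENNReal.ofReal (Real.exp (energy 1 u).toReal) := by
    rw [← hI, expIntegral]
    refine setLIntegral_mono' measurableSet_Ioi fun r hr => ENNReal.ofReal_le_ofReal ?_
    rw [← Real.exp_add, one_mul]
    exact Real.exp_le_exp.2 (by linarith [hle r (le_of_lt hr)])
  refine (ENNReal.log_monotone hb).trans ?_
  rw [log_ofReal_exp, EReal.coe_ennreal_toReal hE]

lemma log_expIntegral_lt {n : ℝ} (hn : 1 < n) {u : ℝ → ℝ} (hu : Admissible u)
    (hE : energy n u ≠ ⊤) :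
    ENNReal.log (ENNReal.ofReal n * expIntegral n u) <
      (sharpCoeff n : EReal) * (energy n u : EReal) + (sharpConst n : EReal) := by
  obtain ⟨D, hD, hle⟩ := expIntegral_lt hn hu hE
  refine (ENNReal.log_monotone hle).trans_lt ?_
  rw [log_ofReal_exp, ← EReal.coe_ennreal_toReal hE, ← EReal.coe_mul, ← EReal.coe_add,
    EReal.coe_lt_coe_iff]
  linarith

lemma coe_mul_ofReal_add (A C : ℝ) {e : ℝ} (he : 0 ≤ e) :
    (A : EReal) * (ENNReal.ofReal e : EReal) + (C : EReal) = ((A * e + C : ℝ) : EReal) := by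
  rw [EReal.coe_ennreal_ofReal, max_eq_left he, ← EReal.coe_mul, ← EReal.coe_add]

lemma exists_gt_of_lt_sharpCoeff {n : ℝ} (hn : 1 < n) {A : ℝ} (hA : A < sharpCoeff n) (C : ℝ) :
    ∃ u : ℝ → ℝ, Admissible u ∧ energy n u ≠ ⊤ ∧
      (A : EReal) * (energy n u : EReal) + (C : EReal) <
        ENNReal.log (ENNReal.ofReal n * expIntegral n u) := by
  have hc := sharpCoeff_pos hn
  have hA' := sub_pos.2 hA
  -- As `slopeInt` is nonnegative, it suffices that the energy exceed `C / (sharpCoeff n - A)`. The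
  -- choice `b = e^{-M}` gives `log ((1 + b)/b) > M`, which forces this.
  set M := slopeInt (n - 1) 1 + sharpCoeff n * (C / (sharpCoeff n - A)) with hM
  obtain ⟨u, hu, e, he, hen, hce, hlog⟩ := exists_extremal hn (Real.exp_pos (-M))
  have hb := Real.exp_pos (-M)
  refine ⟨u, hu, by rw [hen]; exact ENNReal.ofReal_ne_top, ?_⟩
  rw [hen, hlog, coe_mul_ofReal_add A C he, EReal.coe_lt_coe_iff]
  have h1 : M < Real.log ((1 + Real.exp (-M)) / Real.exp (-M)) := by
    rw [Real.lt_log_iff_exp_lt (by positivity), lt_div_iff₀ hb, ← Real.exp_add, add_neg_cancel,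
      Real.exp_zero]
    linarith
  have hm : 0 < n - 1 := by linarith
  have hi0 : 0 ≤ (1 + Real.exp (-M))⁻¹ := by positivity
  have h2 := monotoneOn_slopeInt hm (mem_Ici.2 le_rfl) hi0 hi0
  have h3 := monotoneOn_slopeInt hm hi0 (mem_Ici.2 zero_le_one)
    (inv_le_one_of_one_le₀ (by linarith))
  rw [slopeInt_zero] at h2
  have h4 : C / (sharpCoeff n - A) < e := by
    refine lt_of_mul_lt_mul_left ?_ hc.le
    linarith
  rw [div_lt_iff₀ hA'] at h4
  linarith

/-- The defect `slopeInt (n - 1) (1 + b)⁻¹` tends to the sharp constant as `b → 0`, so it exceeds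
`C` for some `b > 0`. -/
lemma exists_gt_of_lt_sharpConst {n : ℝ} (hn : 1 < n) {C : ℝ} (hC : C < sharpConst n) :
    ∃ u : ℝ → ℝ, Admissible u ∧ energy n u ≠ ⊤ ∧
      (sharpCoeff n : EReal) * (energy n u : EReal) + (C : EReal) <
        ENNReal.log (ENNReal.ofReal n * expIntegral n u) := by
  have hm : 0 < n - 1 := by linarith
  have hcont : ContinuousAt (fun b : ℝ => slopeInt (n - 1) (1 + b)⁻¹) 0 := by
    refine ContinuousAt.comp (hasDerivAt_slopeInt hm.le _).continuousAt ?_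
    exact (continuousAt_const.add continuousAt_id).inv₀ (by norm_num)
  rw [sharpConst_eq hn] at hC
  have hev : ∀ᶠ b in nhds (0 : ℝ), C < slopeInt (n - 1) (1 + b)⁻¹ :=
    hcont.eventually (lt_mem_nhds (by simpa using hC))
  obtain ⟨b, hCb, hb⟩ := ((hev.filter_mono nhdsWithin_le_nhds).and
    (self_mem_nhdsWithin (s := Ioi (0 : ℝ)))).exists
  obtain ⟨u, hu, e, he, hen, hce, hlog⟩ := exists_extremal hn hb
  refine ⟨u, hu, by rw [hen]; exact ENNReal.ofReal_ne_top, ?_⟩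
  rw [hen, hlog, coe_mul_ofReal_add _ C he, EReal.coe_lt_coe_iff]
  linarith

lemma log_expIntegral_le {n : ℝ} (hn : 1 < n) {u : ℝ → ℝ} (hu : Admissible u) :
    ENNReal.log (ENNReal.ofReal n * expIntegral n u) ≤
      (sharpCoeff n : EReal) * (energy n u : EReal) + (sharpConst n : EReal) := by
  by_cases hE : energy n u = ⊤
  · rw [hE, EReal.coe_ennreal_top, EReal.coe_mul_top_of_pos (sharpCoeff_pos hn),
      EReal.top_add_coe]
    exact le_top
  · exact (log_expIntegral_lt hn hu hE).le

end ExpHardy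

end

theorem theorem1 :
    (∀ n : ℝ, 1 < n →
      -- the inequality, between extended real numbers
      (∀ u : ℝ → ℝ, ExpHardy.Admissible u →
        ENNReal.log (ENNReal.ofReal n * ExpHardy.expIntegral n u) ≤
          (ExpHardy.sharpCoeff n : EReal) * (ExpHardy.energy n u : EReal)
            + (ExpHardy.sharpConst n : EReal)) ∧
      -- it is strict as soon as its right-hand side is finite
      (∀ u : ℝ → ℝ, ExpHardy.Admissible u → ExpHardy.energy n u ≠ ⊤ →
        ENNReal.log (ENNReal.ofReal n * ExpHardy.expIntegral n u) <
          (ExpHardy.sharpCoeff n : EReal) * (ExpHardy.energy n u : EReal)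
            + (ExpHardy.sharpConst n : EReal)) ∧
      -- no smaller coefficient is possible, whatever the additive constant
      (∀ A : ℝ, A < ExpHardy.sharpCoeff n → ∀ C : ℝ,
        ∃ u : ℝ → ℝ, ExpHardy.Admissible u ∧ ExpHardy.energy n u ≠ ⊤ ∧
          (A : EReal) * (ExpHardy.energy n u : EReal) + (C : EReal) <
            ENNReal.log (ENNReal.ofReal n * ExpHardy.expIntegral n u)) ∧
      -- with the optimal coefficient, no smaller additive constant is possible
      (∀ C : ℝ, C < ExpHardy.sharpConst n →
        ∃ u : ℝ → ℝ, ExpHardy.Admissible u ∧ ExpHardy.energy n u ≠ ⊤ ∧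
          (ExpHardy.sharpCoeff n : EReal) * (ExpHardy.energy n u : EReal) + (C : EReal) <
            ENNReal.log (ENNReal.ofReal n * ExpHardy.expIntegral n u))) ∧
    (∀ u : ℝ → ℝ, ExpHardy.Admissible u →
      ENNReal.log (ExpHardy.expIntegral 1 u) ≤ (ExpHardy.energy 1 u : EReal)) := by
  exact ⟨fun n hn => ⟨fun u hu => ExpHardy.log_expIntegral_le hn hu,
    fun u hu hE => ExpHardy.log_expIntegral_lt hn hu hE,
    fun A hA C => ExpHardy.exists_gt_of_lt_sharpCoeff hn hA C,
    fun C hC => ExpHardy.exists_gt_of_lt_sharpConst hn hC⟩,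
    fun u hu => ExpHardy.log_expIntegral_one_le hu⟩
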